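/- Let $A\in\mathbb R^{n\times n}$, $B\in\mathbb R^{n\times m}$, $t_0<t_f$. For $Q,F\in\mathbb S^n_+$ (positive semidefinite) and $R\in\mathbb S^m_{++}$ (positive definite), the optimal feedback matrix of the regulator $\min_u\ x(t_f)^{\rm T}Fx(t_f)+\int_{t_0}^{t_f}(x^{\rm T}Qx+u^{\rm T}Ru)\,dt$, $\dot x=Ax+Bu$, is $K(t)=-R^{-1}B^{\rm T}P(t)$, $t\in[t_0,t_f]$, where $P$ solves $\dot P=-A^{\rm T}P-PA+PBR^{-1}B^{\rm T}P-Q$ on $[t_0,t_f]$ with $P(t_f)=F$. Let $K:[t_0,t_f]\to\mathbb R^{m\times n}$ and $R\in\mathbb S^m_{++}$ be given with $RK(t)B=B^{\rm T}K(t)^{\rm T}R$ for all $t\in[t_0,t_f]$, and consider the problem of finding $Q,F\in\mathbb S^n_+$ such that $K$ is the optimal feedback matrix of the regulator with costs $Q,R,F$. Assume that the data are consistent, i.e. that at least one such pair $(Q,F)$ exists. Notation. $\mathrm{vec}$ is column-stacking vectorization, $\mathrm{mat}$ its inverse, $\mathrm{vech}$ half-vectorization, $D_n$ the duplication matrix ($D_n\mathrm{vech}(X)=\mathrm{vec}(X)$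 for symmetric $X$), $M^\dagger$ the Moore–Penrose inverse. Put $\widetilde A=-I_n\otimes A-A\otimes I_n$, $\widetilde B=I_n\otimes B$, $$\widetilde H=[\widetilde B,\widetilde A\widetilde B,\dots,\widetilde A^{n^2}\widetilde B]^{\rm T},\quad \widetilde N=[0,-\widetilde B,-\widetilde A\widetilde B,\dots,-\widetilde A^{n^2-1}\widetilde B]^{\rm T},\quad \widetilde H_d=\widetilde HD_n,\quad \widetilde N_d=\widetilde ND_n,$$ $$U_Q=\widetilde H\widetilde A^{\rm T}D_n(\widetilde H_d^{\rm T}\widetilde H_d)^{-1}\widetilde H_d^{\rm T},\qquad M_Q=U_Q\widetilde N_d+\widetilde H_d,$$ $$P_0(t)=-K(t)^{\rm T}R\,(RK(t)B)^\dagger RK(t),\qquad G=A^{\rm T}P_0+P_0A+P_0BK+\dot P_0,$$ and $g=(g_0,g_1,\dots,g_{n^2})$ (stacked) with $g_0=0$, $g_k(t)=-\sum_{i=0}^{k-1}\widetilde B^{\rm T}(\widetilde A^{\rm T})^i\,\mathrm{vec}\big(G^{(k-1-i)}(t)\big)$; derivatives are taken on $[t_0,t_f]$, one-sided at the end points. Finally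 put $S_Q=-U_Q\,g(t_f)-\widetilde H\,\mathrm{vec}(G(t_f))+\dot g(t_f)$. Proposition. If $(A,B)$ is controllable (i.e. $\operatorname{rank}[B,AB,\dots,A^{n-1}B]=n$) and $M_Q$ has full column rank, then the problem is well-posed: there is exactly one pair $(Q,F)$ of positive semidefinite matrices for which $K$ is the optimal feedback matrix of the regulator with costs $Q,R,F$. Moreover $\widetilde H_d^{\rm T}\widetilde H_d$ and $M_Q^{\rm T}M_Q$ are invertible, $P_0$ and $G$ are smooth on $[t_0,t_f]$, and this pair is $$Q=\mathrm{mat}\big(D_n(M_Q^{\rm T}M_Q)^{-1}M_Q^{\rm T}S_Q\big),\qquad F=P_0(t_f)-\mathrm{mat}\big(D_n(\widetilde H_d^{\rm T}\widetilde H_d)^{-1}\widetilde H_d^{\rm T}[\widetilde N_d\,\mathrm{vech}(Q)+g(t_f)]\big).$$ -/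

import Mathlib

noncomputable section

namespace InverseLQR

open Matrix Set
open scoped Kronecker

/-! ### Linear algebra -/

/-- The four Penrose equations: `X` is a Moore-Penrose inverse of the real matrix `M`. -/
structure IsMoorePenrose {p q : Type*} [Fintype p] [Fintype q]
    (M : Matrix p q ℝ) (X : Matrix q p ℝ) : Prop where
  mul_mul : M * X * M = M
  mul_mul' : X * M * X = X
  symm : (M * X)ᵀ = M * X
  symm' : (X * M)ᵀ = X * M

theorem IsMoorePenrose.unique {p q : Type*} [Fintype p] [Fintype q]
    {M : Matrix p q ℝ} {X Y : Matrix q p ℝ}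
    (hX : IsMoorePenrose M X) (hY : IsMoorePenrose M Y) : X = Y := by
  have h1 : M * X = M * Y := by
    calc M * X = (M * X)ᵀ := hX.symm.symm
      _ = ((M * Y) * (M * X))ᵀ := by rw [← Matrix.mul_assoc, hY.mul_mul]
      _ = (M * X)ᵀ * (M * Y)ᵀ := by rw [Matrix.transpose_mul]
      _ = (M * X) * (M * Y) := by rw [hX.symm, hY.symm]
      _ = M * Y := by rw [← Matrix.mul_assoc, hX.mul_mul]
  have h2 : X * M = Y * M := by
    calc X * M = (X * M)ᵀ := hX.symm'.symm
      _ = ((X * M) * (Y * M))ᵀ := by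
          rw [Matrix.mul_assoc X M (Y * M), ← Matrix.mul_assoc M Y M, hY.mul_mul]
      _ = (Y * M)ᵀ * (X * M)ᵀ := by rw [Matrix.transpose_mul]
      _ = (Y * M) * (X * M) := by rw [hX.symm', hY.symm']
      _ = Y * M := by
          rw [Matrix.mul_assoc Y M (X * M), ← Matrix.mul_assoc M X M, hX.mul_mul]
  calc X = X * M * X := hX.mul_mul'.symm
    _ = Y * (M * X) := by rw [h2, Matrix.mul_assoc]
    _ = Y * M * Y := by rw [h1, Matrix.mul_assoc]
    _ = Y := hY.mul_mul'

theorem exists_isMoorePenrose {p q : Type*} [Fintype p] [Fintype q]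
    (M : Matrix p q ℝ) : ∃ X, IsMoorePenrose M X := by
  classical
  have hS : (Mᵀ * M).IsHermitian := by
    have := Matrix.isHermitian_conjTranspose_mul_self M
    rwa [Matrix.conjTranspose_eq_transpose_of_trivial] at this
  obtain ⟨U, d, hU, hd⟩ : ∃ (U : Matrix q q ℝ) (d : q → ℝ),
      Uᵀ * U = 1 ∧ Mᵀ * M = U * diagonal d * Uᵀ := by
    refine ⟨hS.eigenvectorUnitary, hS.eigenvalues, ?_, ?_⟩
    · have := (Matrix.mem_unitaryGroup_iff').1 hS.eigenvectorUnitary.2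
      rwa [Matrix.star_eq_conjTranspose, Matrix.conjTranspose_eq_transpose_of_trivial] at this
    · have := hS.spectral_theorem
      rw [Unitary.conjStarAlgAut_apply] at this
      rw [Matrix.star_eq_conjTranspose, Matrix.conjTranspose_eq_transpose_of_trivial] at this
      exact this
  set T : Matrix q q ℝ := U * diagonal (fun i => (d i)⁻¹) * Uᵀ with hT
  have key : ∀ a b : q → ℝ, (U * diagonal a * Uᵀ) * (U * diagonal b * Uᵀ)
      = U * diagonal (fun i => a i * b i) * Uᵀ := by
    intro a b
    calc (U * diagonal a * Uᵀ) * (U * diagonal b * Uᵀ)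
        = U * diagonal a * (Uᵀ * U) * diagonal b * Uᵀ := by simp only [Matrix.mul_assoc]
      _ = _ := by rw [hU, Matrix.mul_one, Matrix.mul_assoc U, Matrix.diagonal_mul_diagonal]
  have hsym : ∀ a : q → ℝ, (U * diagonal a * Uᵀ)ᵀ = U * diagonal a * Uᵀ := by
    intro a
    simp [Matrix.transpose_mul, Matrix.mul_assoc]
  have hTt : Tᵀ = T := hsym _
  have hTS : T * (Mᵀ * M) = U * diagonal (fun i => (d i)⁻¹ * d i) * Uᵀ := by rw [hd, hT, key]
  have hSTS : (Mᵀ * M) * T * (Mᵀ * M) = Mᵀ * M := by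
    rw [Matrix.mul_assoc, hTS, hd, key]
    congr 3
    funext i
    by_cases h : d i = 0 <;> simp [h]
  have hTST : T * (Mᵀ * M) * T = T := by
    rw [hTS, hT, key]
    congr 3
    funext i
    by_cases h : d i = 0 <;> simp [h]
  have hM : M * T * Mᵀ * M = M := by
    have h0 : (M * T * Mᵀ * M - M)ᴴ * (M * T * Mᵀ * M - M) = 0 := by
      rw [Matrix.conjTranspose_eq_transpose_of_trivial, Matrix.transpose_sub]
      have e : (M * T * Mᵀ * M)ᵀ = Mᵀ * M * T * Mᵀ := by
        simp [Matrix.transpose_mul, hTt, Matrix.mul_assoc]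
      rw [e, Matrix.sub_mul, Matrix.mul_sub, Matrix.mul_sub]
      have a1 : Mᵀ * M * T * Mᵀ * (M * T * Mᵀ * M) = Mᵀ * M := by
        calc _ = (Mᵀ * M * T * (Mᵀ * M)) * T * (Mᵀ * M) := by simp only [Matrix.mul_assoc]
          _ = _ := by rw [hSTS, hSTS]
      have a2 : Mᵀ * M * T * Mᵀ * M = Mᵀ * M := by
        calc _ = Mᵀ * M * T * (Mᵀ * M) := by simp only [Matrix.mul_assoc]
          _ = _ := hSTS
      have a3 : Mᵀ * (M * T * Mᵀ * M) = Mᵀ * M := by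
        calc _ = Mᵀ * M * T * (Mᵀ * M) := by simp only [Matrix.mul_assoc]
          _ = _ := hSTS
      rw [a1, a2, a3]
      simp
    exact sub_eq_zero.1 (Matrix.conjTranspose_mul_self_eq_zero.1 h0)
  refine ⟨T * Mᵀ, ?_, ?_, ?_, ?_⟩
  · rw [← Matrix.mul_assoc]
    exact hM
  · calc T * Mᵀ * M * (T * Mᵀ) = (T * (Mᵀ * M) * T) * Mᵀ := by simp only [Matrix.mul_assoc]
      _ = T * Mᵀ := by rw [hTST]
  · simp [Matrix.transpose_mul, hTt, Matrix.mul_assoc]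
  · rw [Matrix.mul_assoc, hTS, hsym]

/-- The Moore-Penrose inverse `M†` of a real matrix. -/
def pinv {p q : Type*} [Fintype p] [Fintype q] (M : Matrix p q ℝ) : Matrix q p ℝ :=
  Classical.choose (exists_isMoorePenrose M)

theorem pinv_spec {p q : Type*} [Fintype p] [Fintype q] (M : Matrix p q ℝ) :
    IsMoorePenrose M (pinv M) :=
  Classical.choose_spec (exists_isMoorePenrose M)

/-- Full column rank: the rank equals the number of columns. -/
def FullColumnRank {p q : Type*} [Fintype q] (M : Matrix p q ℝ) : Prop :=
  M.rank = Fintype.card q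

/-- Matricization, the inverse of the column-stacking vectorization `Matrix.vec`
(whose index is the pair (column, row)). -/
def mat {n : ℕ} (v : Fin n × Fin n → ℝ) : Matrix (Fin n) (Fin n) ℝ :=
  Matrix.of fun i j => v (j, i)

/-- The positions (row, column) on or below the diagonal of an `n × n` matrix: the index set of
half-vectorizations, of cardinality `n (n + 1) / 2`. -/
abbrev HalfIdx (n : ℕ) : Type := {p : Fin n × Fin n // p.2 ≤ p.1}

/-- Half-vectorization: the entries on or below the diagonal. -/
def vech {n : ℕ} (X : Matrix (Fin n) (Fin n) ℝ) : HalfIdx n → ℝ :=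
  fun p => X p.1.1 p.1.2

/-- The duplication matrix `D_n`, with `D_n vech(X) = vec(X)` for symmetric `X`. -/
def dupMat (n : ℕ) : Matrix (Fin n × Fin n) (HalfIdx n) ℝ :=
  Matrix.of fun c p => if c = p.1 ∨ c = p.1.swap then 1 else 0

theorem dupMat_mulVec_vech {n : ℕ} (X : Matrix (Fin n) (Fin n) ℝ) (hX : Xᵀ = X) :
    dupMat n *ᵥ vech X = vec X := by
  have hs : ∀ i j, X i j = X j i := fun i j => by
    conv_lhs => rw [← hX, Matrix.transpose_apply]
  funext c
  obtain ⟨j, i⟩ := c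
  simp only [mulVec, dotProduct, dupMat, Matrix.of_apply, vech, vec, ite_mul, one_mul, zero_mul]
  rcases le_total j i with h | h
  · rw [Finset.sum_eq_single (⟨(i, j), h⟩ : HalfIdx n)]
    · simp
    · rintro ⟨⟨a, b⟩, hab⟩ - hne
      rw [if_neg]
      rintro (h' | h') <;> simp only [Prod.swap_prod_mk, Prod.mk.injEq] at h'
      · obtain ⟨rfl, rfl⟩ := h'
        exact hne (by simp [le_antisymm h hab])
      · obtain ⟨rfl, rfl⟩ := h'
        exact hne rfl
    · simp
  · rw [Finset.sum_eq_single (⟨(j, i), h⟩ : HalfIdx n)]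
    · simp [hs i j]
    · rintro ⟨⟨a, b⟩, hab⟩ - hne
      rw [if_neg]
      rintro (h' | h') <;> simp only [Prod.swap_prod_mk, Prod.mk.injEq] at h'
      · obtain ⟨rfl, rfl⟩ := h'
        exact hne rfl
      · obtain ⟨rfl, rfl⟩ := h'
        exact hne (by simp [le_antisymm h hab])
    · simp

/-! ### The linear system and the matrices built from it -/

section System

variable {n m : ℕ}

/-- The controllability matrix `[B, AB, …, A^(n-1) B]`. -/
def ctrbMatrix (A : Matrix (Fin n) (Fin n) ℝ) (B : Matrix (Fin n) (Fin m) ℝ) :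
    Matrix (Fin n) (Fin n × Fin m) ℝ :=
  Matrix.of fun i r => (A ^ (r.1 : ℕ) * B) i r.2

/-- Controllability of the pair `(A, B)`. -/
def Controllable (A : Matrix (Fin n) (Fin n) ℝ) (B : Matrix (Fin n) (Fin m) ℝ) : Prop :=
  (ctrbMatrix A B).rank = n

/-- `Ã = - I ⊗ A - A ⊗ I`. -/
def Atil (A : Matrix (Fin n) (Fin n) ℝ) : Matrix (Fin n × Fin n) (Fin n × Fin n) ℝ :=
  -((1 : Matrix (Fin n) (Fin n) ℝ) ⊗ₖ A) - A ⊗ₖ (1 : Matrix (Fin n) (Fin n) ℝ)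

/-- `B̃ = I ⊗ B`. -/
def Btil (B : Matrix (Fin n) (Fin m) ℝ) : Matrix (Fin n × Fin n) (Fin n × Fin m) ℝ :=
  (1 : Matrix (Fin n) (Fin n) ℝ) ⊗ₖ B

/-- Index of the rows of `H̃`, `Ñ` and `g`: the blocks `0, …, n²`, each of size `n m`. -/
abbrev RowIdx (n m : ℕ) : Type := Fin (n ^ 2 + 1) × (Fin n × Fin m)

/-- `H̃ = [B̃, Ã B̃, …, Ã^(n²) B̃]ᵀ`. -/
def Htil (A : Matrix (Fin n) (Fin n) ℝ) (B : Matrix (Fin n) (Fin m) ℝ) :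
    Matrix (RowIdx n m) (Fin n × Fin n) ℝ :=
  Matrix.of fun r c => (Atil A ^ (r.1 : ℕ) * Btil B) c r.2

/-- `Ñ = [0, -B̃, -Ã B̃, …, -Ã^(n²-1) B̃]ᵀ`. -/
def Ntil (A : Matrix (Fin n) (Fin n) ℝ) (B : Matrix (Fin n) (Fin m) ℝ) :
    Matrix (RowIdx n m) (Fin n × Fin n) ℝ :=
  Matrix.of fun r c =>
    if (r.1 : ℕ) = 0 then 0 else -(Atil A ^ ((r.1 : ℕ) - 1) * Btil B) c r.2

/-- `H̃_d = H̃ D_n`. -/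
def Hd (A : Matrix (Fin n) (Fin n) ℝ) (B : Matrix (Fin n) (Fin m) ℝ) :
    Matrix (RowIdx n m) (HalfIdx n) ℝ :=
  Htil A B * dupMat n

/-- `Ñ_d = Ñ D_n`. -/
def Nd (A : Matrix (Fin n) (Fin n) ℝ) (B : Matrix (Fin n) (Fin m) ℝ) :
    Matrix (RowIdx n m) (HalfIdx n) ℝ :=
  Ntil A B * dupMat n

/-- `U_Q = H̃ Ãᵀ D_n (H̃_dᵀ H̃_d)⁻¹ H̃_dᵀ`. -/
def UQ (A : Matrix (Fin n) (Fin n) ℝ) (B : Matrix (Fin n) (Fin m) ℝ) :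
    Matrix (RowIdx n m) (RowIdx n m) ℝ :=
  Htil A B * (Atil A)ᵀ * dupMat n * ((Hd A B)ᵀ * Hd A B)⁻¹ * (Hd A B)ᵀ

/-- `M_Q = H̃ Ãᵀ D_n (H̃_dᵀ H̃_d)⁻¹ H̃_dᵀ Ñ_d + H̃_d`. -/
def MQ (A : Matrix (Fin n) (Fin n) ℝ) (B : Matrix (Fin n) (Fin m) ℝ) :
    Matrix (RowIdx n m) (HalfIdx n) ℝ :=
  Htil A B * (Atil A)ᵀ * dupMat n * ((Hd A B)ᵀ * Hd A B)⁻¹ * (Hd A B)ᵀ * Nd A B + Hd A B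

/-! ### The inverse problem -/

/-- `P` solves on `[t₀, t_f]` the differential Riccati equation
`P' = - Aᵀ P - P A + P B R⁻¹ Bᵀ P - Q` with `P(t_f) = F`. The derivative is taken entrywise and
is one-sided at the end points. -/
def IsRiccatiSolution (A : Matrix (Fin n) (Fin n) ℝ) (B : Matrix (Fin n) (Fin m) ℝ)
    (R : Matrix (Fin m) (Fin m) ℝ) (Q F : Matrix (Fin n) (Fin n) ℝ) (t₀ tf : ℝ)
    (P : ℝ → Matrix (Fin n) (Fin n) ℝ) : Prop :=
  (∀ t ∈ Icc t₀ tf, ∀ i j, HasDerivWithinAt (fun s => P s i j)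
    ((-(Aᵀ * P t) - P t * A + P t * B * R⁻¹ * Bᵀ * P t - Q) i j) (Icc t₀ tf) t) ∧
  P tf = F

/-- `K` is on `[t₀, t_f]` the optimal feedback matrix `K(t) = - R⁻¹ Bᵀ P(t)` of the linear
quadratic regulator with control cost `R`, state cost `Q` and terminal cost `F`. -/
def IsOptimalFeedback (A : Matrix (Fin n) (Fin n) ℝ) (B : Matrix (Fin n) (Fin m) ℝ)
    (R : Matrix (Fin m) (Fin m) ℝ) (Q F : Matrix (Fin n) (Fin n) ℝ) (t₀ tf : ℝ)
    (K : ℝ → Matrix (Fin m) (Fin n) ℝ) : Prop :=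
  ∃ P : ℝ → Matrix (Fin n) (Fin n) ℝ, IsRiccatiSolution A B R Q F t₀ tf P ∧
    ∀ t ∈ Icc t₀ tf, K t = -(R⁻¹ * Bᵀ * P t)

/-- The pair `(Q, F)` solves the inverse problem in which `K` and only `R` are given: `Q` and `F`
are positive semidefinite and the regulator with costs `Q`, `R`, `F` generates `K`. -/
def SolvesInverseProblem (A : Matrix (Fin n) (Fin n) ℝ) (B : Matrix (Fin n) (Fin m) ℝ)
    (R : Matrix (Fin m) (Fin m) ℝ) (t₀ tf : ℝ) (K : ℝ → Matrix (Fin m) (Fin n) ℝ)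
    (Q F : Matrix (Fin n) (Fin n) ℝ) : Prop :=
  Q.PosSemidef ∧ F.PosSemidef ∧ IsOptimalFeedback A B R Q F t₀ tf K

/-- The set `ℛ_s` of positive definite `R` such that `R K(t) B` is symmetric on `[t₀, t_f]`. -/
def Rs (B : Matrix (Fin n) (Fin m) ℝ) (t₀ tf : ℝ) (K : ℝ → Matrix (Fin m) (Fin n) ℝ) :
    Set (Matrix (Fin m) (Fin m) ℝ) :=
  {R | R.PosDef ∧ ∀ t ∈ Icc t₀ tf, R * K t * B = Bᵀ * (K t)ᵀ * R}

/-! ### The quantities computed from the data -/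

/-- `P₀(t) = - K(t)ᵀ R (R K(t) B)† R K(t)`. -/
def P0 (B : Matrix (Fin n) (Fin m) ℝ) (R : Matrix (Fin m) (Fin m) ℝ)
    (K : ℝ → Matrix (Fin m) (Fin n) ℝ) (t : ℝ) : Matrix (Fin n) (Fin n) ℝ :=
  -((K t)ᵀ * R * pinv (R * K t * B) * R * K t)

/-- The `k`-th derivative on `[t₀, t_f]` of a matrix valued function, taken entrywise. -/
def matDeriv (t₀ tf : ℝ) (k : ℕ) (X : ℝ → Matrix (Fin n) (Fin n) ℝ) (t : ℝ) :
    Matrix (Fin n) (Fin n) ℝ :=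
  Matrix.of fun i j => iteratedDerivWithin k (fun s => X s i j) (Icc t₀ tf) t

/-- `G(t) = Aᵀ P₀(t) + P₀(t) A + P₀(t) B K(t) + P₀'(t)`. -/
def G (A : Matrix (Fin n) (Fin n) ℝ) (B : Matrix (Fin n) (Fin m) ℝ)
    (R : Matrix (Fin m) (Fin m) ℝ) (t₀ tf : ℝ) (K : ℝ → Matrix (Fin m) (Fin n) ℝ)
    (t : ℝ) : Matrix (Fin n) (Fin n) ℝ :=
  Aᵀ * P0 B R K t + P0 B R K t * A + P0 B R K t * B * K t + matDeriv t₀ tf 1 (P0 B R K) t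

/-- The stacked vector `g = (g₀, …, g_(n²))`, with
`g_k(t) = - ∑_(i < k) B̃ᵀ (Ãᵀ)^i vec(G^(k-1-i)(t))`; in particular `g₀ = 0`. -/
def g (A : Matrix (Fin n) (Fin n) ℝ) (B : Matrix (Fin n) (Fin m) ℝ)
    (R : Matrix (Fin m) (Fin m) ℝ) (t₀ tf : ℝ) (K : ℝ → Matrix (Fin m) (Fin n) ℝ)
    (t : ℝ) : RowIdx n m → ℝ :=
  fun r => (-∑ i ∈ Finset.range (r.1 : ℕ), ((Btil B)ᵀ * (Atil A)ᵀ ^ i) *ᵥ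
    vec (matDeriv t₀ tf ((r.1 : ℕ) - 1 - i) (G A B R t₀ tf K) t)) r.2

/-- `S_Q = - U_Q g(t_f) - H̃ vec(G(t_f)) + g'(t_f)`. -/
def SQ (A : Matrix (Fin n) (Fin n) ℝ) (B : Matrix (Fin n) (Fin m) ℝ)
    (R : Matrix (Fin m) (Fin m) ℝ) (t₀ tf : ℝ) (K : ℝ → Matrix (Fin m) (Fin n) ℝ) :
    RowIdx n m → ℝ :=
  -(UQ A B *ᵥ g A B R t₀ tf K tf) - Htil A B *ᵥ vec (G A B R t₀ tf K tf)
    + fun r => derivWithin (fun t => g A B R t₀ tf K t r) (Icc t₀ tf) tf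

/-- `mat(D_n (M_Qᵀ M_Q)⁻¹ M_Qᵀ S_Q)`. -/
def recoveredQ (A : Matrix (Fin n) (Fin n) ℝ) (B : Matrix (Fin n) (Fin m) ℝ)
    (R : Matrix (Fin m) (Fin m) ℝ) (t₀ tf : ℝ) (K : ℝ → Matrix (Fin m) (Fin n) ℝ) :
    Matrix (Fin n) (Fin n) ℝ :=
  mat ((dupMat n * ((MQ A B)ᵀ * MQ A B)⁻¹ * (MQ A B)ᵀ) *ᵥ SQ A B R t₀ tf K)

/-- `F₀ + F̃` with `F₀ = P₀(t_f)` and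
`F̃ = - mat(D_n (H̃_dᵀ H̃_d)⁻¹ H̃_dᵀ (Ñ_d vech(Q) + g(t_f)))`. -/
def recoveredF (A : Matrix (Fin n) (Fin n) ℝ) (B : Matrix (Fin n) (Fin m) ℝ)
    (R : Matrix (Fin m) (Fin m) ℝ) (t₀ tf : ℝ) (K : ℝ → Matrix (Fin m) (Fin n) ℝ)
    (Q : Matrix (Fin n) (Fin n) ℝ) : Matrix (Fin n) (Fin n) ℝ :=
  P0 B R K tf - mat ((dupMat n * ((Hd A B)ᵀ * Hd A B)⁻¹ * (Hd A B)ᵀ) *ᵥ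
    (Nd A B *ᵥ vech Q + g A B R t₀ tf K tf))

end System

end InverseLQR

end

open InverseLQR Set
open scoped Matrix ContDiff

open InverseLQR Set
open scoped Matrix ContDiff

namespace InverseLQR

open Matrix
open scoped Kronecker

/-! ### Rank and injectivity -/

/-! The rank condition on `MQ` is strong: with controllability it forces `Bᵀ` to be injective
(`Bt_mulVec_eq_zero`). If `Bᵀ w = 0`, then `X = w wᵀ` makes `vech (lyap A X)` a kernel vector of
`MQ`; hence `lyap A X = 0`, and controllability gives `X = 0`.

Once `B` can be cancelled, `Bᵀ P = -R K` determines `P` from `K`. Symmetry of `R K B` makes `P`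
symmetric, and a Penrose equation gives `P0 = P` (`P0_eq`). The Riccati equation then reads `G = -Q`
(`G_eq`), so all derivatives of `G` vanish, `g = -Ntil vec Q` and `SQ = MQ vech Q`. Left inverses
recover `Q`, and `F = P(tf)`. Every solution thus equals the recovered pair, which gives uniqueness
and the formulas together. -/

theorem mulVec_eq_zero_of_rank {p q : Type*} [Fintype p] [Fintype q] {M : Matrix p q ℝ}
    (hM : M.rank = Fintype.card q) {v : q → ℝ} (hv : M *ᵥ v = 0) : v = 0 := by
  have h1 := LinearMap.finrank_range_add_finrank_ker M.mulVecLin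
  rw [Module.finrank_fintype_fun_eq_card] at h1
  have h2 : Module.finrank ℝ (LinearMap.ker M.mulVecLin) = 0 := by
    rw [Matrix.rank] at hM
    omega
  have h3 : v ∈ LinearMap.ker M.mulVecLin := by simpa using hv
  rw [Submodule.finrank_eq_zero.1 h2] at h3
  simpa using h3

theorem isUnit_transpose_mul_self {p q : Type*} [Fintype p] [Fintype q] [DecidableEq q]
    {M : Matrix p q ℝ} (hM : ∀ v, M *ᵥ v = 0 → v = 0) : IsUnit (Mᵀ * M) := by
  rw [← Matrix.mulVec_injective_iff_isUnit]
  have h0 : ∀ v, (Mᵀ * M) *ᵥ v = 0 → v = 0 := fun v hv => by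
    apply hM
    have := (Matrix.conjTranspose_mul_self_mulVec_eq_zero M v).1
    rw [Matrix.conjTranspose_eq_transpose_of_trivial] at this
    exact this hv
  intro v w hvw
  have := h0 (v - w) (by rw [Matrix.mulVec_sub]; exact sub_eq_zero.2 hvw)
  exact sub_eq_zero.1 this

theorem mulVec_leftInverse {p q : Type*} [Fintype p] [Fintype q] [DecidableEq q]
    {M : Matrix p q ℝ} (hM : IsUnit (Mᵀ * M)) (v : q → ℝ) :
    ((Mᵀ * M)⁻¹ * Mᵀ) *ᵥ (M *ᵥ v) = v := by
  rw [Matrix.mulVec_mulVec, Matrix.mul_assoc,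
    Matrix.nonsing_inv_mul _ ((Matrix.isUnit_iff_isUnit_det _).1 hM), Matrix.one_mulVec]

/-! ### Vectorization -/

theorem mat_vec {n : ℕ} (X : Matrix (Fin n) (Fin n) ℝ) : mat (vec X) = X := rfl

/-- Allows the kernel of `Hd` to be tested on symmetric matrices, where `Hd` acts as `Htil`. -/
theorem exists_symm_vech_eq {n : ℕ} (y : HalfIdx n → ℝ) :
    ∃ X : Matrix (Fin n) (Fin n) ℝ, Xᵀ = X ∧ vech X = y := by
  refine ⟨Matrix.of fun i j => if h : j ≤ i then y ⟨(i, j), h⟩ else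
    y ⟨(j, i), (not_le.1 h).le⟩, ?_, ?_⟩
  · ext i j
    rcases lt_trichotomy i j with h | rfl | h
    · simp [h.le, not_le.2 h]
    · simp
    · simp [h.le, not_le.2 h]
  · funext p
    obtain ⟨⟨i, j⟩, h⟩ := p
    have h' : j ≤ i := h
    simp [vech, h']

/-! ### The Kronecker matrices as operators on matrices -/

section System

variable {n m : ℕ} {A : Matrix (Fin n) (Fin n) ℝ} {B : Matrix (Fin n) (Fin m) ℝ}

/-- The Lyapunov operator `X ↦ -(Aᵀ X + X A)`. -/
def lyap (A X : Matrix (Fin n) (Fin n) ℝ) : Matrix (Fin n) (Fin n) ℝ :=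
  -(Aᵀ * X) - X * A

theorem lyap_transpose (A : Matrix (Fin n) (Fin n) ℝ) {X : Matrix (Fin n) (Fin n) ℝ}
    (hX : Xᵀ = X) : (lyap A X)ᵀ = lyap A X := by
  simp only [lyap, transpose_sub, transpose_neg, transpose_mul, transpose_transpose, hX]
  abel

theorem Atil_transpose_mulVec_vec (A X : Matrix (Fin n) (Fin n) ℝ) :
    (Atil A)ᵀ *ᵥ vec X = vec (lyap A X) := by
  have h1 := Matrix.kronecker_mulVec_vec Aᵀ X (1 : Matrix (Fin n) (Fin n) ℝ)
  have h2 := Matrix.kronecker_mulVec_vec (1 : Matrix (Fin n) (Fin n) ℝ) X Aᵀ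
  rw [Atil, transpose_sub, transpose_neg, ← kroneckerMap_transpose, ← kroneckerMap_transpose,
    transpose_one, sub_mulVec, neg_mulVec, h1, h2]
  simp [lyap, vec_sub, vec_neg]

theorem Atil_transpose_pow_mulVec_vec (A X : Matrix (Fin n) (Fin n) ℝ) (k : ℕ) :
    (Atil A)ᵀ ^ k *ᵥ vec X = vec ((lyap A)^[k] X) := by
  induction k with
  | zero => simp
  | succ k ih =>
    rw [pow_succ', ← mulVec_mulVec, ih, Atil_transpose_mulVec_vec, Function.iterate_succ_apply']

theorem Btil_transpose_mulVec_vec (B : Matrix (Fin n) (Fin m) ℝ) (X : Matrix (Fin n) (Fin n) ℝ) :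
    (Btil B)ᵀ *ᵥ vec X = vec (Bᵀ * X) := by
  have h1 := Matrix.kronecker_mulVec_vec Bᵀ X (1 : Matrix (Fin n) (Fin n) ℝ)
  rw [Btil, ← kroneckerMap_transpose, transpose_one]
  simpa using h1

theorem Htil_mulVec (A : Matrix (Fin n) (Fin n) ℝ) (B : Matrix (Fin n) (Fin m) ℝ)
    (v : Fin n × Fin n → ℝ) (r : RowIdx n m) :
    (Htil A B *ᵥ v) r = (((Btil B)ᵀ * (Atil A)ᵀ ^ (r.1 : ℕ)) *ᵥ v) r.2 := by
  rw [← transpose_pow, ← transpose_mul]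
  rfl

theorem Ntil_mulVec (A : Matrix (Fin n) (Fin n) ℝ) (B : Matrix (Fin n) (Fin m) ℝ)
    (v : Fin n × Fin n → ℝ) (r : RowIdx n m) :
    (Ntil A B *ᵥ v) r = if (r.1 : ℕ) = 0 then 0 else
      -(((Btil B)ᵀ * (Atil A)ᵀ ^ ((r.1 : ℕ) - 1)) *ᵥ v) r.2 := by
  rw [← transpose_pow, ← transpose_mul]
  by_cases h : (r.1 : ℕ) = 0
  · simp only [mulVec, dotProduct, Ntil, of_apply, if_pos h, zero_mul, Finset.sum_const_zero]
  · simp only [mulVec, dotProduct, Ntil, of_apply, if_neg h, neg_mul, Finset.sum_neg_distrib,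
      transpose_apply]

/-- Along a trajectory of `p' = Ãᵀ p - q` with `q = Ãᵀ p` and `B̃ᵀ p = 0`, the outputs and their
derivatives vanish. -/
theorem Ntil_mulVec_Atil_transpose_mulVec {v : Fin n × Fin n → ℝ} (hv : (Btil B)ᵀ *ᵥ v = 0) :
    Ntil A B *ᵥ ((Atil A)ᵀ *ᵥ v) = -(Htil A B *ᵥ v) := by
  funext r
  rw [Pi.neg_apply, Htil_mulVec, Ntil_mulVec]
  -- Block `k ≥ 1` of `Ntil` is minus block `k - 1` of `Htil`, and the extra factor `Ãᵀ` restores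
  -- the power. Block `0` of `Ntil` is zero, which is where `hv` is needed.
  split_ifs with h
  · simp [h, hv]
  · rw [mulVec_mulVec, Matrix.mul_assoc, ← pow_succ, Nat.sub_add_cancel (Nat.pos_of_ne_zero h)]

theorem Hd_mulVec_vech {X : Matrix (Fin n) (Fin n) ℝ} (hX : Xᵀ = X) :
    Hd A B *ᵥ vech X = Htil A B *ᵥ vec X := by
  rw [Hd, ← mulVec_mulVec, dupMat_mulVec_vech X hX]

theorem Nd_mulVec_vech {X : Matrix (Fin n) (Fin n) ℝ} (hX : Xᵀ = X) :
    Nd A B *ᵥ vech X = Ntil A B *ᵥ vec X := by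
  rw [Nd, ← mulVec_mulVec, dupMat_mulVec_vech X hX]

/-- Since `Bᵀ (Aᵀ)^i lyap(X) = -Bᵀ (Aᵀ)^(i+1) X - (Bᵀ (Aᵀ)^i X) A`, the induction hypothesis for `X`
kills the last term and the one for `lyap A X` kills the left side. Hence the quantification over
`X`. -/
theorem Bt_mul_At_pow_mul_eq_zero (k : ℕ) : ∀ X : Matrix (Fin n) (Fin n) ℝ,
    (∀ j ≤ k, Bᵀ * (lyap A)^[j] X = 0) → ∀ j ≤ k, Bᵀ * Aᵀ ^ j * X = 0 := by
  induction k with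
  | zero =>
    intro X hX j hj
    obtain rfl : j = 0 := by omega
    simpa using hX 0 le_rfl
  | succ k ih =>
    intro X hX j hj
    have h1 := ih X (fun j hj => hX j (by omega))
    have h2 := ih (lyap A X) (fun j hj => by
      rw [← Function.iterate_succ_apply]
      exact hX (j + 1) (by omega))
    rcases Nat.lt_or_ge k j with hkj | hkj
    · obtain ⟨i, rfl⟩ : ∃ i, j = i + 1 := ⟨j - 1, by omega⟩
      have h3 := h2 i (by omega)
      have h4 := h1 i (by omega)
      rw [lyap, Matrix.mul_sub, ← Matrix.mul_assoc _ X A, h4, Matrix.zero_mul, sub_zero,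
        Matrix.mul_neg, neg_eq_zero, ← Matrix.mul_assoc, Matrix.mul_assoc Bᵀ, ← pow_succ] at h3
      exact h3
    · exact h1 j hkj

/-- Each column of `X` lies in the kernel of the transposed controllability matrix. -/
theorem Controllable.eq_zero (hAB : Controllable A B) {X : Matrix (Fin n) (Fin n) ℝ}
    (hX : ∀ j < n, Bᵀ * Aᵀ ^ j * X = 0) : X = 0 := by
  have hr : (ctrbMatrix A B)ᵀ.rank = Fintype.card (Fin n) := by
    rw [rank_transpose, Fintype.card_fin]
    exact hAB
  have hcol : ∀ j, X.col j = 0 := fun j => by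
    refine mulVec_eq_zero_of_rank hr ?_
    funext r
    have h := congrFun (congrFun (hX r.1 r.1.2) r.2) j
    rw [← transpose_pow, ← transpose_mul] at h
    exact h
  ext i j
  exact congrFun (hcol j) i

theorem Htil_mulVec_vec_eq_zero (hAB : Controllable A B) {X : Matrix (Fin n) (Fin n) ℝ}
    (hX : Htil A B *ᵥ vec X = 0) : X = 0 := by
  refine hAB.eq_zero fun j hj => ?_
  refine Bt_mul_At_pow_mul_eq_zero (n ^ 2) X (fun k hk => ?_) j ?_
  · apply vec_inj.1
    rw [← Btil_transpose_mulVec_vec, ← Atil_transpose_pow_mulVec_vec, mulVec_mulVec]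
    funext c
    have := congrFun hX (⟨k, by omega⟩, c)
    rw [Htil_mulVec] at this
    exact this
  -- The powers up to `n²` in `Htil` cover all those below `n`.
  · nlinarith

theorem Hd_mulVec_eq_zero (hAB : Controllable A B) (y : HalfIdx n → ℝ)
    (hy : Hd A B *ᵥ y = 0) : y = 0 := by
  obtain ⟨X, hX, rfl⟩ := exists_symm_vech_eq y
  rw [Hd_mulVec_vech hX] at hy
  rw [Htil_mulVec_vec_eq_zero hAB hy]
  rfl

theorem isUnit_Hd (hAB : Controllable A B) : IsUnit ((Hd A B)ᵀ * Hd A B) :=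
  isUnit_transpose_mul_self (Hd_mulVec_eq_zero hAB)

/-! ### The rank condition on `MQ` and full row rank of `B` -/

theorem MQ_eq (A : Matrix (Fin n) (Fin n) ℝ) (B : Matrix (Fin n) (Fin m) ℝ) :
    MQ A B = UQ A B * Nd A B + Hd A B := rfl

/-- The right factor of `UQ` is a left inverse of `Hd`, so it returns `vech X`; the remaining
factors apply `Htil Ãᵀ` to `vec X`. -/
theorem UQ_mulVec_Htil_mulVec_vec (hAB : Controllable A B) {X : Matrix (Fin n) (Fin n) ℝ}
    (hX : Xᵀ = X) : UQ A B *ᵥ (Htil A B *ᵥ vec X) = Htil A B *ᵥ ((Atil A)ᵀ *ᵥ vec X) := by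
  have h := mulVec_leftInverse (isUnit_Hd hAB) (vech X)
  have e : UQ A B = Htil A B * (Atil A)ᵀ * dupMat n * (((Hd A B)ᵀ * Hd A B)⁻¹ * (Hd A B)ᵀ) := by
    simp only [UQ, Matrix.mul_assoc]
  rw [← Hd_mulVec_vech hX, e, ← mulVec_mulVec, h, ← mulVec_mulVec, dupMat_mulVec_vech X hX,
    ← mulVec_mulVec]

/-- If `M_Q` has full column rank, then `B` has full row rank: a symmetric `X` with `Bᵀ X = 0`
yields the element `vech (Aᵀ X + X A)` of the kernel of `M_Q`. -/
theorem Bt_mulVec_eq_zero (hAB : Controllable A B) (hMQ : FullColumnRank (MQ A B))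
    {w : Fin n → ℝ} (hw : Bᵀ *ᵥ w = 0) : w = 0 := by
  set X : Matrix (Fin n) (Fin n) ℝ := vecMulVec w w with hXdef
  have hX : Xᵀ = X := by rw [hXdef, transpose_vecMulVec]
  have hBX : (Btil B)ᵀ *ᵥ vec X = 0 := by
    rw [Btil_transpose_mulVec_vec, hXdef, mul_vecMulVec, hw]
    ext
    simp [vecMulVec, vec]
  have hL : (lyap A X)ᵀ = lyap A X := lyap_transpose A hX
  have hker : MQ A B *ᵥ vech (lyap A X) = 0 := by
    rw [MQ_eq, add_mulVec, ← mulVec_mulVec, Nd_mulVec_vech hL, Hd_mulVec_vech hL,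
      ← Atil_transpose_mulVec_vec, Ntil_mulVec_Atil_transpose_mulVec hBX, mulVec_neg,
      UQ_mulVec_Htil_mulVec_vec hAB hX, neg_add_cancel]
  have hLX : vec (lyap A X) = 0 := by
    rw [← dupMat_mulVec_vech _ hL, mulVec_eq_zero_of_rank hMQ hker, mulVec_zero]
  -- The shift identity is used again: `Htil vec X = -Ntil vec (lyap A X) = 0`.
  have hX0 : X = 0 := by
    apply Htil_mulVec_vec_eq_zero hAB (B := B)
    rw [← neg_eq_zero, ← Ntil_mulVec_Atil_transpose_mulVec hBX, Atil_transpose_mulVec_vec, hLX,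
      mulVec_zero]
  funext i
  -- The diagonal entries of `X` are the squares `w i * w i`.
  have := congrFun (congrFun hX0 i) i
  simpa [hXdef, vecMulVec] using this

/-! ### Entrywise smoothness -/

theorem contDiffOn_mul_apply {p q r : Type*} [Fintype q] {s : Set ℝ} {k : WithTop ℕ∞}
    {X : ℝ → Matrix p q ℝ} {Y : ℝ → Matrix q r ℝ}
    (hX : ∀ i j, ContDiffOn ℝ k (fun t => X t i j) s)
    (hY : ∀ i j, ContDiffOn ℝ k (fun t => Y t i j) s) (i : p) (j : r) :
    ContDiffOn ℝ k (fun t => (X t * Y t) i j) s := by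
  simp only [mul_apply]
  exact ContDiffOn.sum fun l _ => (hX i l).mul (hY l j)

/-- Bootstrapping: the right side of the Riccati equation is polynomial in `P`, so each order of
smoothness yields the next. -/
theorem IsRiccatiSolution.contDiffOn {R : Matrix (Fin m) (Fin m) ℝ}
    {Q F : Matrix (Fin n) (Fin n) ℝ} {t₀ tf : ℝ} (ht : t₀ < tf)
    {P : ℝ → Matrix (Fin n) (Fin n) ℝ} (hP : IsRiccatiSolution A B R Q F t₀ tf P) (i j : Fin n) :
    ContDiffOn ℝ ∞ (fun t => P t i j) (Icc t₀ tf) := by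
  suffices h : ∀ k : ℕ, ∀ i j, ContDiffOn ℝ k (fun t => P t i j) (Icc t₀ tf) from
    contDiffOn_infty.2 fun k => h k i j
  intro k
  induction k with
  | zero =>
    intro i j
    exact contDiffOn_zero.2 fun t ht' => (hP.1 t ht' i j).continuousWithinAt
  | succ k ih =>
    intro i j
    have hud := uniqueDiffOn_Icc ht
    push_cast
    rw [contDiffOn_succ_iff_derivWithin hud]
    refine ⟨fun t ht' => (hP.1 t ht' i j).differentiableWithinAt, by simp, ?_⟩
    have hc : ∀ {p q : ℕ} (M : Matrix (Fin p) (Fin q) ℝ) (i j),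
        ContDiffOn ℝ k (fun _ : ℝ => M i j) (Icc t₀ tf) := fun M i j => contDiffOn_const
    refine ContDiffOn.congr (f := fun t => (-(Aᵀ * P t) - P t * A
      + P t * B * R⁻¹ * Bᵀ * P t - Q) i j) ?_
      (fun t ht' => (hP.1 t ht' i j).derivWithin (hud t ht'))
    simp only [Matrix.sub_apply, Matrix.add_apply, Matrix.neg_apply]
    refine (((contDiffOn_mul_apply (hc Aᵀ) ih i j).neg.sub
      (contDiffOn_mul_apply ih (hc A) i j)).add ?_).sub (hc Q i j)
    exact contDiffOn_mul_apply (contDiffOn_mul_apply (contDiffOn_mul_apply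
      (contDiffOn_mul_apply ih (hc B)) (hc R⁻¹)) (hc Bᵀ)) ih i j

theorem matDeriv_of_eqOn_const {t₀ tf : ℝ} {X : ℝ → Matrix (Fin n) (Fin n) ℝ}
    {C : Matrix (Fin n) (Fin n) ℝ} (hX : ∀ t ∈ Icc t₀ tf, X t = C) (k : ℕ) {t : ℝ}
    (ht : t ∈ Icc t₀ tf) : matDeriv t₀ tf k X t = if k = 0 then C else 0 := by
  ext i j
  have h : iteratedDerivWithin k (fun s => X s i j) (Icc t₀ tf) t
      = iteratedDerivWithin k (fun _ => C i j) (Icc t₀ tf) t :=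
    iteratedDerivWithin_congr (fun s hs => by simp only [hX s hs]) ht
  rw [matDeriv, of_apply, h, iteratedDerivWithin_const]
  split_ifs <;> rfl

/-! ### The data generated by a regulator when `B` has full row rank -/

section Generated

variable {R : Matrix (Fin m) (Fin m) ℝ} {Q F : Matrix (Fin n) (Fin n) ℝ} {t₀ tf : ℝ}
  {K : ℝ → Matrix (Fin m) (Fin n) ℝ} {P : ℝ → Matrix (Fin n) (Fin n) ℝ}

theorem eq_of_Bt_mul_eq {q : Type*} (hB : ∀ w, Bᵀ *ᵥ w = 0 → w = 0) {X Y : Matrix (Fin n) q ℝ}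
    (h : Bᵀ * X = Bᵀ * Y) : X = Y := by
  rw [← sub_eq_zero, ← Matrix.mul_sub] at h
  have hcol : ∀ j, (X - Y).col j = 0 := fun j => hB _ (by
    funext i
    exact congrFun (congrFun h i) j)
  ext i j
  exact sub_eq_zero.1 (congrFun (hcol j) i)

theorem eq_of_mul_B_eq {q : Type*} (hB : ∀ w, Bᵀ *ᵥ w = 0 → w = 0) {X Y : Matrix q (Fin n) ℝ}
    (h : X * B = Y * B) : X = Y := by
  apply transpose_injective
  apply eq_of_Bt_mul_eq hB
  rw [← transpose_mul, ← transpose_mul, h]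

theorem R_mul_K (hR : R.PosDef) {t : ℝ} (hK : K t = -(R⁻¹ * Bᵀ * P t)) :
    R * K t = -(Bᵀ * P t) := by
  rw [hK, Matrix.mul_neg, ← Matrix.mul_assoc, ← Matrix.mul_assoc,
    mul_nonsing_inv _ ((isUnit_iff_isUnit_det _).1 hR.isUnit), Matrix.one_mul]

/-- Symmetry of `R K B` says `Bᵀ P B = Bᵀ Pᵀ B`, and `B` cancels on both sides. No uniqueness
theorem for the Riccati equation is needed. -/
theorem transpose_eq_of_feedback (hB : ∀ w, Bᵀ *ᵥ w = 0 → w = 0) (hR : R ∈ Rs B t₀ tf K)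
    {t : ℝ} (ht : t ∈ Icc t₀ tf) (hK : K t = -(R⁻¹ * Bᵀ * P t)) : (P t)ᵀ = P t := by
  have hRt : Rᵀ = R := by
    have := hR.1.isHermitian.eq
    rwa [conjTranspose_eq_transpose_of_trivial] at this
  have h1 := hR.2 t ht
  have h2 : (K t)ᵀ * R = -((P t)ᵀ * B) := by
    conv_lhs => rw [← hRt]
    rw [← transpose_mul, R_mul_K hR.1 hK, transpose_neg, transpose_mul, transpose_transpose]
  rw [Matrix.mul_assoc Bᵀ, h2, R_mul_K hR.1 hK, Matrix.neg_mul, Matrix.mul_neg, neg_inj,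
    Matrix.mul_assoc] at h1
  exact (eq_of_mul_B_eq hB (eq_of_Bt_mul_eq hB h1)).symm

/-- With `S = R K B = -Bᵀ P B`, cancelling `Bᵀ` and `B` in `S S† S = S` leaves `P B S† Bᵀ P = -P`.
-/
theorem P0_eq (hB : ∀ w, Bᵀ *ᵥ w = 0 → w = 0) (hR : R ∈ Rs B t₀ tf K)
    {t : ℝ} (ht : t ∈ Icc t₀ tf) (hK : K t = -(R⁻¹ * Bᵀ * P t)) : P0 B R K t = P t := by
  have hRt : Rᵀ = R := by
    have := hR.1.isHermitian.eq
    rwa [conjTranspose_eq_transpose_of_trivial] at this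
  have hRK := R_mul_K hR.1 hK
  have hKR : (K t)ᵀ * R = -(P t * B) := by
    conv_lhs => rw [← hRt]
    rw [← transpose_mul, hRK, transpose_neg, transpose_mul, transpose_transpose,
      transpose_eq_of_feedback hB hR ht hK]
  have hS := (pinv_spec (R * K t * B)).mul_mul
  set X := pinv (R * K t * B) with hX
  have key : P t * B * X * (Bᵀ * P t) = -P t := by
    apply eq_of_mul_B_eq hB
    apply eq_of_Bt_mul_eq hB
    rw [hRK] at hS
    calc Bᵀ * (P t * B * X * (Bᵀ * P t) * B)
        = -(Bᵀ * P t) * B * X * (-(Bᵀ * P t) * B) := by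
          simp only [Matrix.neg_mul, Matrix.mul_neg, neg_neg, Matrix.mul_assoc]
      _ = -(Bᵀ * P t) * B := hS
      _ = Bᵀ * (-P t * B) := by simp only [Matrix.neg_mul, Matrix.mul_neg, Matrix.mul_assoc]
  rw [P0, ← hX, hKR, Matrix.mul_assoc _ R, hRK, Matrix.neg_mul, Matrix.neg_mul, Matrix.mul_neg,
    neg_neg, key, neg_neg]

/-- With `P0 = P`, the term `P B K` is minus the quadratic Riccati term, so everything in `G` but
`-Q` cancels. -/
theorem G_eq (ht : t₀ < tf) (hB : ∀ w, Bᵀ *ᵥ w = 0 → w = 0) (hR : R ∈ Rs B t₀ tf K)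
    (hP : IsRiccatiSolution A B R Q F t₀ tf P)
    (hK : ∀ t ∈ Icc t₀ tf, K t = -(R⁻¹ * Bᵀ * P t)) {t : ℝ} (ht' : t ∈ Icc t₀ tf) :
    G A B R t₀ tf K t = -Q := by
  have hd : matDeriv t₀ tf 1 (P0 B R K) t
      = -(Aᵀ * P t) - P t * A + P t * B * R⁻¹ * Bᵀ * P t - Q := by
    ext i j
    rw [matDeriv, of_apply, iteratedDerivWithin_one,
      derivWithin_congr (f := fun s => P s i j)
        (fun s hs => by simp only [P0_eq hB hR hs (hK s hs)])
        (by simp only [P0_eq hB hR ht' (hK t ht')])]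
    exact (hP.1 t ht' i j).derivWithin (uniqueDiffOn_Icc ht t ht')
  rw [G, hd, P0_eq hB hR ht' (hK t ht'), hK t ht', Matrix.mul_neg]
  simp only [Matrix.mul_assoc]
  abel

theorem g_eq (hG : ∀ t ∈ Icc t₀ tf, G A B R t₀ tf K t = -Q) {t : ℝ} (ht : t ∈ Icc t₀ tf) :
    g A B R t₀ tf K t = -(Ntil A B *ᵥ vec Q) := by
  funext r
  rw [g, Pi.neg_apply, Pi.neg_apply, Ntil_mulVec]
  simp only [matDeriv_of_eqOn_const hG _ ht]
  split_ifs with h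
  · simp [h]
  -- Only the last summand contains the undifferentiated `G`; the others contain derivatives of a
  -- constant.
  · rw [Finset.sum_eq_single ((r.1 : ℕ) - 1)]
    · simp [vec_neg, mulVec_neg]
    · intro i hi hne
      rw [Finset.mem_range] at hi
      rw [if_neg (by omega), vec_zero, mulVec_zero]
    · intro hi
      exact absurd (Finset.mem_range.2 (by omega)) hi

/-- Here `g` is constant, so its derivative drops out; the other two terms give the two summands of
`MQ`. -/
theorem SQ_eq (ht : t₀ ≤ tf) (hQ : Qᵀ = Q) (hG : ∀ t ∈ Icc t₀ tf, G A B R t₀ tf K t = -Q) :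
    SQ A B R t₀ tf K = MQ A B *ᵥ vech Q := by
  have htf : tf ∈ Icc t₀ tf := right_mem_Icc.2 ht
  have hd : (fun r => derivWithin (fun t => g A B R t₀ tf K t r) (Icc t₀ tf) tf)
      = (0 : RowIdx n m → ℝ) := by
    funext r
    rw [derivWithin_congr (f := fun _ => (-(Ntil A B *ᵥ vec Q)) r)
      (fun s hs => by simp only [g_eq hG hs]) (by simp only [g_eq hG htf])]
    simp
  rw [SQ, hd, g_eq hG htf, hG tf htf, MQ_eq, add_mulVec, ← mulVec_mulVec, Nd_mulVec_vech hQ,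
    Hd_mulVec_vech hQ, vec_neg, mulVec_neg, mulVec_neg, neg_neg, sub_neg_eq_add, add_zero]

theorem recoveredQ_eq (ht : t₀ ≤ tf) (hMQ : IsUnit ((MQ A B)ᵀ * MQ A B)) (hQ : Qᵀ = Q)
    (hG : ∀ t ∈ Icc t₀ tf, G A B R t₀ tf K t = -Q) : recoveredQ A B R t₀ tf K = Q := by
  rw [recoveredQ, SQ_eq ht hQ hG, Matrix.mul_assoc, ← mulVec_mulVec, mulVec_leftInverse hMQ,
    dupMat_mulVec_vech Q hQ, mat_vec]

/-- The correction to `P0` vanishes because `g(tf)` cancels `Nd vech Q`. -/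
theorem recoveredF_eq (ht : t₀ ≤ tf) (hQ : Qᵀ = Q)
    (hG : ∀ t ∈ Icc t₀ tf, G A B R t₀ tf K t = -Q) :
    recoveredF A B R t₀ tf K Q = P0 B R K tf := by
  have h0 : mat (0 : Fin n × Fin n → ℝ) = 0 := rfl
  rw [recoveredF, g_eq hG (right_mem_Icc.2 ht), Nd_mulVec_vech hQ, add_neg_cancel, mulVec_zero,
    h0, sub_zero]

end Generated

end System

end InverseLQR

/-! ### Well-posedness and the recovery formulas -/

theorem mainTheorem9 (n m : ℕ)
    (A : Matrix (Fin n) (Fin n) ℝ) (B : Matrix (Fin n) (Fin m) ℝ)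
    (t₀ tf : ℝ) (ht : t₀ < tf)
    (K : ℝ → Matrix (Fin m) (Fin n) ℝ)
    (R : Matrix (Fin m) (Fin m) ℝ) (hR : R ∈ Rs B t₀ tf K)
    (hK : ∃ Q F : Matrix (Fin n) (Fin n) ℝ, SolvesInverseProblem A B R t₀ tf K Q F)
    (hAB : Controllable A B) (hMQ : FullColumnRank (MQ A B)) :
    IsUnit ((Hd A B)ᵀ * Hd A B) ∧ IsUnit ((MQ A B)ᵀ * MQ A B) ∧
    (∀ i j, ContDiffOn ℝ ∞ (fun t => P0 B R K t i j) (Icc t₀ tf)) ∧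
    (∀ i j, ContDiffOn ℝ ∞ (fun t => G A B R t₀ tf K t i j) (Icc t₀ tf)) ∧
    (∃! QF : Matrix (Fin n) (Fin n) ℝ × Matrix (Fin n) (Fin n) ℝ,
      SolvesInverseProblem A B R t₀ tf K QF.1 QF.2) ∧
    SolvesInverseProblem A B R t₀ tf K (recoveredQ A B R t₀ tf K)
      (recoveredF A B R t₀ tf K (recoveredQ A B R t₀ tf K)) := by
  have hMQu : IsUnit ((MQ A B)ᵀ * MQ A B) :=
    isUnit_transpose_mul_self fun v hv => mulVec_eq_zero_of_rank hMQ hv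
  have hB : ∀ w, Bᵀ *ᵥ w = 0 → w = 0 := fun w hw => Bt_mulVec_eq_zero hAB hMQ hw
  -- The recovered pair depends only on the data, so this makes any two solutions equal; `hK`
  -- supplies existence and semidefiniteness.
  have hrec : ∀ Q F, SolvesInverseProblem A B R t₀ tf K Q F →
      (∀ t ∈ Icc t₀ tf, G A B R t₀ tf K t = -Q) ∧ recoveredQ A B R t₀ tf K = Q ∧
        recoveredF A B R t₀ tf K (recoveredQ A B R t₀ tf K) = F := by
    rintro Q F ⟨hQ, -, P, hP, hKP⟩
    have hQt : Qᵀ = Q := by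
      have := hQ.isHermitian.eq
      rwa [Matrix.conjTranspose_eq_transpose_of_trivial] at this
    have htf : tf ∈ Icc t₀ tf := right_mem_Icc.2 ht.le
    have hG := fun t (h : t ∈ Icc t₀ tf) => G_eq ht hB hR hP hKP h
    have hQr := recoveredQ_eq ht.le hMQu hQt hG
    refine ⟨hG, hQr, ?_⟩
    rw [hQr, recoveredF_eq ht.le hQt hG, P0_eq hB hR htf (hKP tf htf), hP.2]
  obtain ⟨Q, F, hQF⟩ := hK
  obtain ⟨hG, hQr, hFr⟩ := hrec Q F hQF
  refine ⟨isUnit_Hd hAB, hMQu, fun i j => ?_, fun i j => ?_, ⟨(Q, F), hQF, ?_⟩, ?_⟩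
  · obtain ⟨-, -, P, hP, hKP⟩ := hQF
    exact (hP.contDiffOn ht i j).congr fun t h => by rw [P0_eq hB hR h (hKP t h)]
  · exact contDiffOn_const.congr fun t h => by rw [hG t h]
  · rintro ⟨Q', F'⟩ h'
    obtain ⟨-, hQr', hFr'⟩ := hrec Q' F' h'
    exact Prod.ext (hQr'.symm.trans hQr) (hFr'.symm.trans hFr)
  · rw [hFr, hQr]
    exact hQF
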